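/- Let $\nu$ be a northeast path, i.e. a finite lattice path in $\mathbb{N}^2$ starting at the origin with north steps $N=(0,1)$ and east steps $E=(1,0)$. Let $F_\nu$ be the Ferrers diagram lying weakly above $\nu$ in the smallest rectangle containing $\nu$, and let $A_\nu$ be the set of lattice points in $F_\nu$. Two points $p,q\in A_\nu$ are $\nu$-incompatible if one of them lies strictly southwest of the other and the smallest rectangle containing both lies entirely in $F_\nu$; otherwise they are $\nu$-compatible. The $\nu$-Tamari complex $\mathcal{TC}(\nu)$ is the simplicial complex whose faces are the sets of pairwise $\nu$-compatible elements of $A_\nu$. It is a triangulation of a ball. Let $d'=\dim\mathcal{TC}(\nu)+1$. Let $f_{i-1}$ be the number of faces of $\mathcal{TC}(\nu)$ with $i$ elements (so $f_{-1}=1$, for the empty face), define the $h$-vector $(h_0,\dots,h_{d'})$ by $$\sum_{i=0}^{d'}h_i x^i=\sum_{i=0}^{d'}f_{i-1}\,x^i(1-x)^{d'-i},$$ and put $\tilde h_{\mathcal{TC}(\nu)}(x)=\sum_{i=0}^{d'}h_i x^i$. A nonempty face is called interior if it is not contained in the boundary of $\mathcal{TC}(\nu)$, i.e. in no face with $d'-1$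 elements that is contained in exactly one facet; the empty face is not interior. Let $f^{\mathrm{int}}_{i-1}$ be the number of interior faces with $i$ elements, and put $\tilde f^{\,\mathrm{int}}_{\mathcal{TC}(\nu)}(x)=\sum_{i=0}^{d'}f^{\mathrm{int}}_{i-1}x^i$. Then $$x^{d'}\,\tilde h_{\mathcal{TC}(\nu)}\!\left(\frac{x+1}{x}\right)=\tilde f^{\,\mathrm{int}}_{\mathcal{TC}(\nu)}(x),$$ as rational functions in $x$, and hence for every nonzero element $x$ of every field. -/

import Mathlib

open Polynomial

/-- A step of a northeast path: `N = (0,1)` or `E = (1,0)`. -/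
inductive NEStep
  | N : NEStep
  | E : NEStep
  deriving DecidableEq

/-- A northeast path, starting at the origin, written as a word in `N` and `E`. -/
abbrev NEPath := List NEStep

namespace NEPath

/-- The set of lattice points visited by the path `ν`. -/
def points (ν : NEPath) : Set (ℕ × ℕ) :=
  {p | ∃ w : NEPath, w <+: ν ∧ p = (w.count NEStep.E, w.count NEStep.N)}

/-- The set `A_ν` of lattice points of the Ferrers diagram that lies weakly above `ν` in the
smallest rectangle containing `ν`. -/
def latticePoints (ν : NEPath) : Set (ℕ × ℕ) :=
  {p | p.2 ≤ ν.count NEStep.N ∧ ∃ q ∈ ν.points, q.1 = p.1 ∧ q.2 ≤ p.2}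

/-- `p` lies strictly southwest of `q`, and the rectangle with lower left corner `p` and upper
right corner `q` lies in the Ferrers diagram of `ν`. -/
def IncompatibleSW (ν : NEPath) (p q : ℕ × ℕ) : Prop :=
  p.1 < q.1 ∧ p.2 < q.2 ∧ Set.Icc p q ⊆ ν.latticePoints

/-- `ν`-compatibility of two lattice points. -/
def Compatible (ν : NEPath) (p q : ℕ × ℕ) : Prop :=
  ¬ (ν.IncompatibleSW p q ∨ ν.IncompatibleSW q p)

/-- The `ν`-Tamari complex: its faces are the `ν`-faces, that is, the sets of pairwise
`ν`-compatible elements of `A_ν`. As always for Mathlib's complexes, the empty face is not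
listed among the faces; it is taken into account in the `f`-vector below. -/
def tamariComplex (ν : NEPath) : PreAbstractSimplicialComplex (ℕ × ℕ) where
  faces := {s | s.Nonempty ∧ ↑s ⊆ ν.latticePoints ∧
    ∀ p ∈ s, ∀ q ∈ s, ν.Compatible p q}
  isRelLowerSet_faces := by
    intro s hs
    refine ⟨hs.1, fun t hts ht => ⟨ht, fun x hx => hs.2.1 (hts hx), fun p hp q hq => ?_⟩⟩
    exact hs.2.2 p (hts hp) q (hts hq)

end NEPath

namespace PreAbstractSimplicialComplex

variable {α : Type*}

/-- `dim K + 1`, the largest number of vertices of a face of the (finite) complex `K`. -/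
noncomputable def dimSucc (K : PreAbstractSimplicialComplex α) : ℕ :=
  sSup {k | ∃ s ∈ K, s.card = k}

/-- `K.faceCount i` is `f_{i-1}(K)`, the number of faces with `i` vertices, including the empty
face, so that `f_{-1}(K) = 1`. -/
noncomputable def faceCount (K : PreAbstractSimplicialComplex α) (i : ℕ) : ℕ :=
  {s : Finset α | (s = ∅ ∨ s ∈ K) ∧ s.card = i}.ncard

/-- The entry `h_i(K)` of the `h`-vector, where, with `d = dim K + 1`,
`∑ h_i x^i = ∑_{i=0}^{d} f_{i-1} x^i (1-x)^{d-i}`. -/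
noncomputable def hVector (K : PreAbstractSimplicialComplex α) (i : ℕ) : ℤ :=
  (∑ j ∈ Finset.range (K.dimSucc + 1),
    (K.faceCount j : ℤ[X]) * X ^ j * (1 - X) ^ (K.dimSucc - j)).coeff i

/-- The polynomial `h̃_K(x) = ∑_{i=0}^{d} h_i(K) x^i` with `d = dim K + 1`. -/
noncomputable def hTilde (K : PreAbstractSimplicialComplex α) : ℤ[X] :=
  ∑ i ∈ Finset.range (K.dimSucc + 1), C (K.hVector i) * X ^ i

/-- A facet is a maximal face. -/
def IsFacet (K : PreAbstractSimplicialComplex α) (t : Finset α) : Prop :=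
  Maximal (· ∈ K) t

/-- The boundary of a triangulated ball `K`: it is generated by the faces of codimension one that
are contained in exactly one facet. -/
def IsBoundaryFace (K : PreAbstractSimplicialComplex α) (s : Finset α) : Prop :=
  ∃ r : Finset α, s ⊆ r ∧ r.card + 1 = K.dimSucc ∧ ∃! t : Finset α, K.IsFacet t ∧ r ⊆ t

/-- Interior faces: the nonempty faces that do not lie in the boundary. -/
def IsInteriorFace (K : PreAbstractSimplicialComplex α) (s : Finset α) : Prop :=
  s ∈ K ∧ ¬ K.IsBoundaryFace s

/-- `K.interiorFaceCount i` is `f_{i-1}^int(K)`, the number of interior faces with `i` vertices. -/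
noncomputable def interiorFaceCount (K : PreAbstractSimplicialComplex α) (i : ℕ) : ℕ :=
  {s : Finset α | K.IsInteriorFace s ∧ s.card = i}.ncard

/-- The polynomial `f̃^int_K(x) = ∑_{i=0}^{d} f_{i-1}^int(K) x^i` with `d = dim K + 1`. -/
noncomputable def fTildeInt (K : PreAbstractSimplicialComplex α) : ℤ[X] :=
  ∑ i ∈ Finset.range (K.dimSucc + 1), (K.interiorFaceCount i : ℤ[X]) * X ^ i

end PreAbstractSimplicialComplex

/-! Since `1 - (x+1)/x = -1/x`, the left side equals `∑ (x+1)^|t| (-1)^(d-|t|)` over all faces `t`,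
the empty one included. Expanding `(x+1)^|t|` over the subsets of `t` makes the coefficient attached
to a face `s` equal to `(-1)^d ∑_{t ⊇ s} (-1)^|t|`, up to sign the reduced Euler characteristic of
the link of `s`. It must be 1 for interior faces and 0 for the others.

No topology of balls is used. Everything is proved for staircases restricted to a set `C` of columns
and a set `R` of rows, with `d = |C| + |R| - 1`. The last point `v` of the lowest row crosses
nothing, so the complex is a cone over the link of `v`. That link is the union of the complexes
obtained by deleting the row or the column of `v`, and these meet in the complex with both deleted.
Induction with inclusion-exclusion gives `signedCount_eq`: the sum is `(-1)^d` if `s` contains the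
upper left corner and meets every row and column, and 0 otherwise. The same recursion gives purity.

It remains to see that this covering condition characterizes interior faces (`isInteriorFace_iff`).
In codimension one, the Euler characteristic itself counts the facets around a ridge. -/

/-! ### Noncrossing sets of a restricted staircase -/

/-- The points `p`, `q` span a rectangle, with `p` as its lower left corner, whose lower right
corner satisfies `P`. -/
def Crossing (P : ℕ → ℕ → Prop) (p q : ℕ × ℕ) : Prop :=
  p.1 < q.1 ∧ p.2 < q.2 ∧ P q.1 p.2

open Classical in
/-- The sets of pairwise noncrossing points of the diagram `P`, restricted to the columns in `C`
and the rows in `R`. -/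
noncomputable def noncrossingSets (P : ℕ → ℕ → Prop) (C R : Finset ℕ) :
    Finset (Finset (ℕ × ℕ)) :=
  (C ×ˢ R).powerset.filter fun s =>
    (∀ p ∈ s, P p.1 p.2) ∧ ∀ p ∈ s, ∀ q ∈ s, ¬ Crossing P p q

theorem mem_noncrossingSets {P : ℕ → ℕ → Prop} {C R : Finset ℕ} {s : Finset (ℕ × ℕ)} :
    s ∈ noncrossingSets P C R ↔ (∀ p ∈ s, p.1 ∈ C ∧ p.2 ∈ R ∧ P p.1 p.2) ∧
      ∀ p ∈ s, ∀ q ∈ s, ¬ Crossing P p q := by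
  simp only [noncrossingSets, Finset.mem_filter, Finset.mem_powerset, Finset.subset_iff,
    Finset.mem_product]
  constructor
  · rintro ⟨h, h', h''⟩
    exact ⟨fun p hp => ⟨(h hp).1, (h hp).2, h' p hp⟩, h''⟩
  · rintro ⟨h, h'⟩
    exact ⟨fun p hp => ⟨(h p hp).1, (h p hp).2.1⟩, fun p hp => (h p hp).2.2, h'⟩

theorem noncrossingSets_of_subset {P : ℕ → ℕ → Prop} {C R : Finset ℕ} {s t : Finset (ℕ × ℕ)}
    (ht : t ∈ noncrossingSets P C R) (hst : s ⊆ t) : s ∈ noncrossingSets P C R := by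
  rw [mem_noncrossingSets] at ht ⊢
  exact ⟨fun p hp => ht.1 p (hst hp), fun p hp q hq => ht.2 p (hst hp) q (hst hq)⟩

theorem noncrossingSets_mono {P : ℕ → ℕ → Prop} {C C' R R' : Finset ℕ} (hC : C ⊆ C')
    (hR : R ⊆ R') : noncrossingSets P C R ⊆ noncrossingSets P C' R' := by
  intro s hs
  rw [mem_noncrossingSets] at hs ⊢
  exact ⟨fun p hp => ⟨hC (hs.1 p hp).1, hR (hs.1 p hp).2.1, (hs.1 p hp).2.2⟩, hs.2⟩

theorem mem_noncrossingSets_eraseRow {P : ℕ → ℕ → Prop} {C R : Finset ℕ}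
    {s : Finset (ℕ × ℕ)} {y : ℕ} :
    s ∈ noncrossingSets P C (R.erase y) ↔ s ∈ noncrossingSets P C R ∧ ∀ p ∈ s, p.2 ≠ y := by
  simp only [mem_noncrossingSets, Finset.mem_erase]
  constructor
  · rintro ⟨h, h'⟩
    exact ⟨⟨fun p hp => ⟨(h p hp).1, (h p hp).2.1.2, (h p hp).2.2⟩, h'⟩,
      fun p hp => (h p hp).2.1.1⟩
  · rintro ⟨⟨h, h'⟩, h''⟩
    exact ⟨fun p hp => ⟨(h p hp).1, ⟨h'' p hp, (h p hp).2.1⟩, (h p hp).2.2⟩, h'⟩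

theorem mem_noncrossingSets_eraseCol {P : ℕ → ℕ → Prop} {C R : Finset ℕ}
    {s : Finset (ℕ × ℕ)} {x : ℕ} :
    s ∈ noncrossingSets P (C.erase x) R ↔ s ∈ noncrossingSets P C R ∧ ∀ p ∈ s, p.1 ≠ x := by
  simp only [mem_noncrossingSets, Finset.mem_erase]
  constructor
  · rintro ⟨h, h'⟩
    exact ⟨⟨fun p hp => ⟨(h p hp).1.2, (h p hp).2⟩, h'⟩, fun p hp => (h p hp).1.1⟩
  · rintro ⟨⟨h, h'⟩, h''⟩
    exact ⟨fun p hp => ⟨⟨h'' p hp, (h p hp).1⟩, (h p hp).2⟩, h'⟩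

/-- The signed number of noncrossing sets that contain `s`. -/
noncomputable def signedCount (P : ℕ → ℕ → Prop) (C R : Finset ℕ)
    (s : Finset (ℕ × ℕ)) : ℤ :=
  ∑ t ∈ noncrossingSets P C R with s ⊆ t, (-1) ^ t.card

/-- The diagram `P`, restricted to the columns in `C` and the rows in `R`, is a staircase whose
upper left corner is `(0, n)`. -/
structure IsStaircase (P : ℕ → ℕ → Prop) (n : ℕ) (C R : Finset ℕ) : Prop where
  mono : ∀ ⦃x x' y y'⦄, P x y → x' ≤ x → y ≤ y' → P x' y'
  zero_mem : 0 ∈ C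
  top_mem : n ∈ R
  le_top : ∀ y ∈ R, y ≤ n
  left : ∀ y ∈ R, P 0 y
  top : ∀ x ∈ C, P x n

/-- The point `v` is the last point of the lowest row. -/
structure IsLowerCorner (P : ℕ → ℕ → Prop) (C R : Finset ℕ) (v : ℕ × ℕ) : Prop where
  fst_mem : v.1 ∈ C
  snd_mem : v.2 ∈ R
  mem : P v.1 v.2
  lowest : ∀ y ∈ R, v.2 ≤ y
  last : ∀ x ∈ C, P x v.2 → x ≤ v.1

namespace IsStaircase

variable {P : ℕ → ℕ → Prop} {n : ℕ} {C R : Finset ℕ}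

theorem exists_isLowerCorner (h : IsStaircase P n C R) : ∃ v, IsLowerCorner P C R v := by
  classical
  have hR : R.Nonempty := ⟨n, h.top_mem⟩
  have hC : (C.filter fun x => P x (R.min' hR)).Nonempty :=
    ⟨0, Finset.mem_filter.2 ⟨h.zero_mem, h.left _ (R.min'_mem hR)⟩⟩
  have hm := Finset.mem_filter.1 (Finset.max'_mem _ hC)
  exact ⟨(Finset.max' _ hC, R.min' hR), hm.1, R.min'_mem hR, hm.2, fun y hy => R.min'_le y hy,
    fun x hx hP => Finset.le_max' _ _ (Finset.mem_filter.2 ⟨hx, hP⟩)⟩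

theorem eraseRow (h : IsStaircase P n C R) {y : ℕ} (hy : y ≠ n) :
    IsStaircase P n C (R.erase y) :=
  ⟨h.mono, h.zero_mem, Finset.mem_erase.2 ⟨hy.symm, h.top_mem⟩,
    fun z hz => h.le_top z (Finset.mem_of_mem_erase hz),
    fun z hz => h.left z (Finset.mem_of_mem_erase hz), h.top⟩

theorem eraseCol (h : IsStaircase P n C R) {x : ℕ} (hx : x ≠ 0) :
    IsStaircase P n (C.erase x) R :=
  ⟨h.mono, Finset.mem_erase.2 ⟨hx.symm, h.zero_mem⟩, h.top_mem, h.le_top, h.left,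
    fun z hz => h.top z (Finset.mem_of_mem_erase hz)⟩

/-- The upper left corner has no row above it and no column to its left, so it crosses nothing. -/
theorem insert_root_mem (h : IsStaircase P n C R) {s : Finset (ℕ × ℕ)}
    (hs : s ∈ noncrossingSets P C R) : insert (0, n) s ∈ noncrossingSets P C R := by
  rw [mem_noncrossingSets] at hs ⊢
  simp only [Finset.mem_insert, forall_eq_or_imp]
  refine ⟨⟨⟨h.zero_mem, h.top_mem, h.left n h.top_mem⟩, hs.1⟩,
    ⟨fun hc => lt_irrefl _ hc.1, fun q hq hc => ?_⟩, fun p hp => ⟨fun hc => ?_, hs.2 p hp⟩⟩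
  · exact absurd (h.le_top _ (hs.1 q hq).2.1) (not_le.2 hc.2.1)
  · exact absurd hc.1 (Nat.not_lt_zero _)

end IsStaircase

/-! ### The cone point and its link -/

namespace IsLowerCorner

variable {P : ℕ → ℕ → Prop} {n : ℕ} {C R : Finset ℕ} {v : ℕ × ℕ}

/-- No row lies below `v`, and a rectangle with lower left corner `v` would have its lower right
corner in the row of `v` beyond the last point. So `v` crosses nothing and is a cone point. -/
theorem insert_mem (hv : IsLowerCorner P C R v) {s : Finset (ℕ × ℕ)}
    (hs : s ∈ noncrossingSets P C R) : insert v s ∈ noncrossingSets P C R := by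
  rw [mem_noncrossingSets] at hs ⊢
  simp only [Finset.mem_insert, forall_eq_or_imp]
  refine ⟨⟨⟨hv.fst_mem, hv.snd_mem, hv.mem⟩, hs.1⟩,
    ⟨fun hc => lt_irrefl _ hc.1, fun q hq hc => ?_⟩, fun p hp => ⟨fun hc => ?_, hs.2 p hp⟩⟩
  · exact absurd (hv.last _ (hs.1 q hq).1 hc.2.2) (not_le.2 hc.1)
  · exact absurd (hv.lowest _ (hs.1 p hp).2.1) (not_le.2 hc.2.1)

/-- Two such points would span a rectangle whose lower right corner is `v` itself, hence would
cross. -/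
theorem not_row_and_col (hm : ∀ ⦃x x' y y'⦄, P x y → x' ≤ x → y ≤ y' → P x' y')
    (hv : IsLowerCorner P C R v) {s : Finset (ℕ × ℕ)} (hs : s ∈ noncrossingSets P C R) (hvs : v ∉ s)
    {x y : ℕ} (hx : (x, v.2) ∈ s) (hy : (v.1, y) ∈ s) : False := by
  rw [mem_noncrossingSets] at hs
  have hx1 := hv.last x (hs.1 _ hx).1 (hs.1 _ hx).2.2
  have hy1 := hv.lowest y (hs.1 _ hy).2.1
  have hx2 : x ≠ v.1 := fun h => hvs (by rwa [h] at hx)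
  have hy2 : v.2 ≠ y := fun h => hvs (by rwa [← h] at hy)
  exact hs.2 _ hx _ hy ⟨lt_of_le_of_ne hx1 hx2, lt_of_le_of_ne hy1 hy2, hm hv.mem le_rfl le_rfl⟩

theorem mem_link (hm : ∀ ⦃x x' y y'⦄, P x y → x' ≤ x → y ≤ y' → P x' y')
    (hv : IsLowerCorner P C R v) {s : Finset (ℕ × ℕ)} :
    s ∈ noncrossingSets P C (R.erase v.2) ∪ noncrossingSets P (C.erase v.1) R ↔
      s ∈ noncrossingSets P C R ∧ v ∉ s := by
  rw [Finset.mem_union, mem_noncrossingSets_eraseRow, mem_noncrossingSets_eraseCol, ← and_or_left, and_congr_right_iff]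
  intro hs
  constructor
  · rintro (h | h) hvs
    · exact h v hvs rfl
    · exact h v hvs rfl
  · intro hvs
    by_contra! hcon
    obtain ⟨⟨p, hp, hp2⟩, q, hq, hq1⟩ := hcon
    refine hv.not_row_and_col hm hs hvs (x := p.1) (y := q.2) ?_ ?_
    · rwa [← hp2]
    · rwa [← hq1]

/-- Toggling the cone point `v` is a sign-reversing involution. -/
theorem signedCount_of_notMem (hv : IsLowerCorner P C R v) {s : Finset (ℕ × ℕ)} (hs : v ∉ s) :
    signedCount P C R s = 0 := by
  unfold signedCount
  refine Finset.sum_involution (fun t _ => if v ∈ t then t.erase v else insert v t) ?_ ?_ ?_ ?_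
  · intro t _
    split_ifs with h
    · rw [← Finset.card_erase_add_one h, pow_succ]; ring
    · rw [Finset.card_insert_of_notMem h, pow_succ]; ring
  · intro t _ _
    split_ifs with h
    · exact fun he => Finset.notMem_erase v t (by rw [he]; exact h)
    · exact fun he => h (he ▸ Finset.mem_insert_self v t)
  · intro t ht
    rw [Finset.mem_filter] at ht
    split_ifs with h
    · exact Finset.mem_filter.2 ⟨noncrossingSets_of_subset ht.1 (Finset.erase_subset v t),
        Finset.subset_erase.2 ⟨ht.2, hs⟩⟩
    · exact Finset.mem_filter.2 ⟨hv.insert_mem ht.1, ht.2.trans (Finset.subset_insert v t)⟩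
  · intro t _
    split_ifs with h h' h'
    · exact absurd h' (Finset.notMem_erase v t)
    · exact Finset.insert_erase h
    · exact Finset.erase_insert h
    · exact absurd (Finset.mem_insert_self v t) h'

/-- Removing `v` flips the sign and lands in the link, which is a union of two restricted complexes;
inclusion-exclusion does the rest. -/
theorem signedCount_of_mem (hm : ∀ ⦃x x' y y'⦄, P x y → x' ≤ x → y ≤ y' → P x' y')
    (hv : IsLowerCorner P C R v) {s : Finset (ℕ × ℕ)} (hs : v ∈ s) :
    signedCount P C R s = signedCount P (C.erase v.1) (R.erase v.2) (s.erase v)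
      - signedCount P C (R.erase v.2) (s.erase v) - signedCount P (C.erase v.1) R (s.erase v) := by
  have key : signedCount P C R s = -∑ t ∈ noncrossingSets P C (R.erase v.2) ∪
      noncrossingSets P (C.erase v.1) R with s.erase v ⊆ t, (-1) ^ t.card := by
    rw [signedCount, ← Finset.sum_neg_distrib]
    refine Finset.sum_bij' (fun t _ => t.erase v) (fun t _ => insert v t) ?_ ?_ ?_ ?_ ?_
    · intro t ht
      rw [Finset.mem_filter] at ht
      rw [Finset.mem_filter, hv.mem_link hm]
      exact ⟨⟨noncrossingSets_of_subset ht.1 (Finset.erase_subset v t), Finset.notMem_erase v t⟩,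
        Finset.erase_subset_erase v ht.2⟩
    · intro t ht
      rw [Finset.mem_filter, hv.mem_link hm] at ht
      exact Finset.mem_filter.2 ⟨hv.insert_mem ht.1.1, Finset.subset_insert_iff.2 ht.2⟩
    · intro t ht
      exact Finset.insert_erase ((Finset.mem_filter.1 ht).2 hs)
    · intro t ht
      rw [Finset.mem_filter, hv.mem_link hm] at ht
      exact Finset.erase_insert ht.1.2
    · intro t ht
      rw [← Finset.card_erase_add_one ((Finset.mem_filter.1 ht).2 hs), pow_succ]; ring
  have hinter : noncrossingSets P C (R.erase v.2) ∩ noncrossingSets P (C.erase v.1) R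
      = noncrossingSets P (C.erase v.1) (R.erase v.2) := by
    ext t
    rw [Finset.mem_inter, mem_noncrossingSets_eraseRow, mem_noncrossingSets_eraseRow, mem_noncrossingSets_eraseCol]
    tauto
  have := Finset.sum_union_inter (s₁ := {t ∈ noncrossingSets P C (R.erase v.2) | s.erase v ⊆ t})
    (s₂ := {t ∈ noncrossingSets P (C.erase v.1) R | s.erase v ⊆ t})
    (f := fun t => (-1 : ℤ) ^ t.card)
  rw [← Finset.filter_union, ← Finset.filter_inter_distrib, hinter] at this
  rw [key]
  unfold signedCount
  linarith

end IsLowerCorner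

/-! ### Euler characteristics of links -/

/-- The set `s` contains the root `(0, n)` and a point of every row in `R` and of every column
in `C`. -/
def Covers (n : ℕ) (C R : Finset ℕ) (s : Finset (ℕ × ℕ)) : Prop :=
  (0, n) ∈ s ∧ (∀ y ∈ R, ∃ p ∈ s, p.2 = y) ∧ ∀ x ∈ C, ∃ p ∈ s, p.1 = x

theorem forall_mem_exists_erase {β : Type*} [DecidableEq β] {f : ℕ × ℕ → β} {R : Finset β}
    {s : Finset (ℕ × ℕ)} {v : ℕ × ℕ} (hv : v ∈ s) :
    (∀ y ∈ R, ∃ p ∈ s, f p = y) ↔ ∀ y ∈ R.erase (f v), ∃ p ∈ s.erase v, f p = y := by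
  constructor
  · intro h y hy
    obtain ⟨p, hp, rfl⟩ := h y (Finset.mem_of_mem_erase hy)
    exact ⟨p, Finset.mem_erase.2 ⟨fun h => Finset.ne_of_mem_erase hy (h ▸ rfl), hp⟩, rfl⟩
  · intro h y hy
    by_cases hyv : y = f v
    · exact ⟨v, hv, hyv.symm⟩
    · obtain ⟨p, hp, rfl⟩ := h y (Finset.mem_erase.2 ⟨hyv, hy⟩)
      exact ⟨p, Finset.mem_of_mem_erase hp, rfl⟩

theorem forall_mem_iff_erase {β : Type*} [DecidableEq β] {R : Finset β} {p : β → Prop} {b : β}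
    (hb : b ∈ R) : (∀ y ∈ R, p y) ↔ (∀ y ∈ R.erase b, p y) ∧ p b := by
  conv_lhs => rw [← Finset.insert_erase hb]
  rw [Finset.forall_mem_insert, and_comm]

theorem signedCount_of_notMem_noncrossingSets {P : ℕ → ℕ → Prop} {C R : Finset ℕ}
    {s : Finset (ℕ × ℕ)} (hs : s ∉ noncrossingSets P C R) : signedCount P C R s = 0 := by
  rw [signedCount, Finset.filter_eq_empty_iff.2, Finset.sum_empty]
  exact fun t ht hst => hs (noncrossingSets_of_subset ht hst)

theorem noncrossingSets_empty_row (P : ℕ → ℕ → Prop) (C : Finset ℕ) :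
    noncrossingSets P C ∅ = {∅} := by
  ext s
  rw [mem_noncrossingSets, Finset.mem_singleton]
  constructor
  · rintro ⟨h, -⟩
    exact Finset.eq_empty_of_forall_notMem fun p hp => Finset.notMem_empty _ (h p hp).2.1
  · rintro rfl
    simp

theorem signedCount_empty_row (P : ℕ → ℕ → Prop) (C C' : Finset ℕ) (s : Finset (ℕ × ℕ)) :
    signedCount P C ∅ s = signedCount P C' ∅ s := by
  simp only [signedCount, noncrossingSets_empty_row]

namespace IsStaircase

variable {P : ℕ → ℕ → Prop} {n : ℕ} {C R : Finset ℕ} {v : ℕ × ℕ}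

theorem rows_eq_singleton (h : IsStaircase P n C R) (hv : IsLowerCorner P C R v) (hvn : v.2 = n) :
    R = {n} :=
  Finset.eq_singleton_iff_unique_mem.2
    ⟨h.top_mem, fun y hy => le_antisymm (h.le_top y hy) (hvn ▸ hv.lowest y hy)⟩

theorem cols_eq_singleton (h : IsStaircase P n C R) (hv : IsLowerCorner P C R v) (hv0 : v = (0, n)) :
    C = {0} := by
  subst hv0
  exact Finset.eq_singleton_iff_unique_mem.2
    ⟨h.zero_mem, fun x hx => Nat.le_zero.1 (hv.last x hx (h.top x hx))⟩

/-- Here `v` is the only point of its row, so deleting its column empties that row. -/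
theorem noncrossingSets_eraseCol_zero (hv : IsLowerCorner P C R v) (hv0 : v.1 = 0) :
    noncrossingSets P (C.erase v.1) R = noncrossingSets P (C.erase v.1) (R.erase v.2) := by
  ext t
  rw [mem_noncrossingSets_eraseRow, iff_self_and]
  intro ht p hp hp2
  have := (mem_noncrossingSets.1 ht).1 p hp
  rw [hp2, hv0, Finset.mem_erase] at this
  exact this.1.1 (Nat.le_zero.1 (hv0 ▸ hv.last _ this.1.2 this.2.2))

theorem signedCount_eraseCol_zero (hv : IsLowerCorner P C R v) (hv0 : v.1 = 0)
    (s : Finset (ℕ × ℕ)) :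
    signedCount P (C.erase v.1) R s = signedCount P (C.erase v.1) (R.erase v.2) s := by
  rw [signedCount, noncrossingSets_eraseCol_zero hv hv0, signedCount]

/-- The links of the noncrossing complex of a staircase have the Euler characteristic of a sphere
or of a ball. -/
theorem signedCount_eq (h : IsStaircase P n C R) (s : Finset (ℕ × ℕ)) [Decidable (Covers n C R s)] :
    signedCount P C R s = if s ∈ noncrossingSets P C R ∧ Covers n C R s then
      (-1) ^ (C.card + R.card + 1) else 0 := by
  classical
  induction hk : C.card + R.card using Nat.strong_induction_on generalizing C R s with
  | _ k ih =>
  subst hk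
  by_cases hs : s ∈ noncrossingSets P C R
  swap
  · rw [signedCount_of_notMem_noncrossingSets hs, if_neg fun h => hs h.1]
  obtain ⟨v, hv⟩ := h.exists_isLowerCorner
  have hcC := Finset.card_erase_add_one hv.fst_mem
  have hcR := Finset.card_erase_add_one hv.snd_mem
  by_cases hvs : v ∈ s
  swap
  · rw [hv.signedCount_of_notMem hvs, if_neg]
    rintro ⟨-, -, hrow, hcol⟩
    obtain ⟨p, hp, hp2⟩ := hrow _ hv.snd_mem
    obtain ⟨q, hq, hq1⟩ := hcol _ hv.fst_mem
    refine hv.not_row_and_col h.mono hs hvs (x := p.1) (y := q.2) ?_ ?_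
    · rwa [← hp2]
    · rwa [← hq1]
  rw [hv.signedCount_of_mem h.mono hvs]
  have hs' : s.erase v ∈ noncrossingSets P C R :=
    noncrossingSets_of_subset hs (Finset.erase_subset v s)
  have hvs' := Finset.notMem_erase v s
  have hnot : ¬ ((∃ p ∈ s.erase v, p.2 = v.2) ∧ ∃ p ∈ s.erase v, p.1 = v.1) := by
    rintro ⟨⟨p, hp, hp2⟩, q, hq, hq1⟩
    refine hv.not_row_and_col h.mono hs' hvs' (x := p.1) (y := q.2) ?_ ?_
    · rwa [← hp2]
    · rwa [← hq1]
  have hroot : v ≠ (0, n) → ((0, n) ∈ s ↔ (0, n) ∈ s.erase v) := fun hne => by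
    rw [Finset.mem_erase]
    exact ⟨fun h => ⟨hne.symm, h⟩, fun h => h.2⟩
  have hrow : s.erase v ∈ noncrossingSets P C (R.erase v.2) ↔ ¬ ∃ p ∈ s.erase v, p.2 = v.2 := by
    rw [mem_noncrossingSets_eraseRow, and_iff_right hs']
    push Not
    rfl
  have hcol : s.erase v ∈ noncrossingSets P (C.erase v.1) R ↔ ¬ ∃ p ∈ s.erase v, p.1 = v.1 := by
    rw [mem_noncrossingSets_eraseCol, and_iff_right hs']
    push Not
    rfl
  have hboth : s.erase v ∈ noncrossingSets P (C.erase v.1) (R.erase v.2) ↔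
      (¬ ∃ p ∈ s.erase v, p.1 = v.1) ∧ ¬ ∃ p ∈ s.erase v, p.2 = v.2 := by
    rw [mem_noncrossingSets_eraseRow, hcol]
    push Not
    rfl
  have hcov : Covers n C R s ↔ (0, n) ∈ s ∧
      (∀ y ∈ R.erase v.2, ∃ p ∈ s.erase v, p.2 = y) ∧
      ∀ x ∈ C.erase v.1, ∃ p ∈ s.erase v, p.1 = x := by
    rw [Covers, forall_mem_exists_erase (f := Prod.snd) hvs,
      forall_mem_exists_erase (f := Prod.fst) hvs]
  -- Deleting the top row or column 0 destroys the root, so the induction hypothesis is unavailable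
  -- there. In the two mixed cases the offending term cancels against the doubly restricted one.
  by_cases hv2 : v.2 = n <;> by_cases hv1 : v.1 = 0
  · have hv0 : v = (0, n) := Prod.ext hv1 hv2
    have hR := h.rows_eq_singleton hv hv2
    have hC := h.cols_eq_singleton hv hv0
    have hse : s = {v} := Finset.eq_singleton_iff_unique_mem.2 ⟨hvs, fun p hp => by
      have := (mem_noncrossingSets.1 hs).1 p hp
      rw [hC, hR, Finset.mem_singleton, Finset.mem_singleton] at this
      rw [hv0]
      exact Prod.ext this.1 this.2.1⟩
    rw [signedCount_eraseCol_zero hv hv1,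
      if_pos ⟨hs, hcov.2 ⟨hv0 ▸ hvs, by simp [hR, hv2], by simp [hC, hv1]⟩⟩]
    have hone : ∀ C', signedCount P C' ∅ ∅ = 1 := fun C' => by
      simp [signedCount, noncrossingSets_empty_row]
    simp [hR, hC, hse, hv2, hone]
  · have hR := h.rows_eq_singleton hv hv2
    have hne : v ≠ (0, n) := fun e => hv1 (by rw [e])
    have hRe : R.erase v.2 = ∅ := by rw [hR, hv2, Finset.erase_singleton]
    rw [hRe, signedCount_empty_row P (C.erase v.1) C, sub_self, zero_sub,
      ih _ (by omega) (h.eraseCol hv1) _ rfl]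
    have hiff : (s.erase v ∈ noncrossingSets P (C.erase v.1) R ∧
        Covers n (C.erase v.1) R (s.erase v)) ↔ (s ∈ noncrossingSets P C R ∧ Covers n C R s) := by
      rw [hcov, and_iff_right hs, hroot hne, Covers, hRe, hcol]
      constructor
      · rintro ⟨-, h1, h2, h3⟩
        exact ⟨h1, by simp, h3⟩
      · rintro ⟨h1, -, h3⟩
        refine ⟨?_, h1, ?_, h3⟩
        · refine fun hc => hnot ⟨⟨_, h1, hv2.symm⟩, hc⟩
        · rw [hR]
          exact fun y hy => ⟨_, h1, (Finset.mem_singleton.1 hy).symm⟩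
    rw [← hcC, add_right_comm _ 1, pow_succ _ (_ + 1)]
    simp only [hiff]
    split_ifs <;> ring
  · have hne : v ≠ (0, n) := fun e => hv2 (by rw [e])
    rw [signedCount_eraseCol_zero hv hv1,
      sub_sub_cancel_left, ih _ (by omega) (h.eraseRow hv2) _ rfl]
    have hiff : (s.erase v ∈ noncrossingSets P C (R.erase v.2) ∧
        Covers n C (R.erase v.2) (s.erase v)) ↔ (s ∈ noncrossingSets P C R ∧ Covers n C R s) := by
      rw [hcov, and_iff_right hs, hroot hne, Covers, hrow, forall_mem_iff_erase hv.fst_mem]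
      constructor
      · rintro ⟨-, h1, h2, h3, -⟩
        exact ⟨h1, h2, h3⟩
      · rintro ⟨h1, h2, h3⟩
        exact ⟨fun hc => hnot ⟨hc, ⟨_, h1, hv1.symm⟩⟩, h1, h2, h3, ⟨_, h1, hv1.symm⟩⟩
    rw [← hcR, ← add_assoc, pow_succ _ (_ + 1)]
    simp only [hiff]
    split_ifs <;> ring
  · have hne : v ≠ (0, n) := fun e => hv1 (by rw [e])
    rw [ih _ (by omega) ((h.eraseCol hv1).eraseRow hv2) _ rfl, ih _ (by omega) (h.eraseRow hv2) _ rfl,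
      ih _ (by omega) (h.eraseCol hv1) _ rfl, ← hcC, ← hcR]
    simp only [hcov]
    simp only [hboth, hrow, hcol, and_iff_right hs, hroot hne, Covers,
      forall_mem_iff_erase (p := fun y => ∃ p ∈ s.erase v, p.2 = y) hv.snd_mem,
      forall_mem_iff_erase (p := fun x => ∃ p ∈ s.erase v, p.1 = x) hv.fst_mem]
    -- At most one of the three terms can survive: a restricted set must avoid each deleted line and
    -- meet each kept one, and `s.erase v` cannot meet both lines through `v`.
    by_cases ha : ∃ p ∈ s.erase v, p.1 = v.1 <;> by_cases hb : ∃ p ∈ s.erase v, p.2 = v.2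
    · exact absurd ⟨hb, ha⟩ hnot
    all_goals
      simp only [ha, hb, not_true_eq_false, not_false_eq_true, and_true, true_and, and_false,
        false_and, if_false]
      split_ifs <;> ring

/-! ### Dimension and purity -/

/-- The recursion behind `card_le` and `exists_superset_card_eq`: one of the two deletions can
always be chosen so as to keep the root, except when the staircase is a single point. -/
theorem erase_mem_cases (h : IsStaircase P n C R) (hv : IsLowerCorner P C R v)
    {s : Finset (ℕ × ℕ)} (hs : s ∈ noncrossingSets P C R) :
    (v = (0, n) ∧ s.erase v = ∅) ∨
      (v.2 ≠ n ∧ s.erase v ∈ noncrossingSets P C (R.erase v.2)) ∨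
      (v.1 ≠ 0 ∧ s.erase v ∈ noncrossingSets P (C.erase v.1) R) := by
  have hlink := (hv.mem_link h.mono).2 ⟨noncrossingSets_of_subset hs (Finset.erase_subset v s),
    Finset.notMem_erase v s⟩
  rw [Finset.mem_union] at hlink
  by_cases hv2 : v.2 = n <;> by_cases hv1 : v.1 = 0
  · have hR := h.rows_eq_singleton hv hv2
    rw [noncrossingSets_eraseCol_zero hv hv1] at hlink
    refine Or.inl ⟨Prod.ext hv1 hv2, ?_⟩
    simpa [hR, hv2, noncrossingSets_empty_row] using hlink
  · have hR := h.rows_eq_singleton hv hv2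
    refine Or.inr (Or.inr ⟨hv1, hlink.elim (fun h' => ?_) id⟩)
    rw [hR, hv2, Finset.erase_singleton, noncrossingSets_empty_row,
      ← noncrossingSets_empty_row P (C.erase v.1)] at h'
    exact noncrossingSets_mono subset_rfl (Finset.empty_subset _) h'
  · rw [noncrossingSets_eraseCol_zero hv hv1] at hlink
    exact Or.inr (Or.inl ⟨hv2, hlink.elim id
      fun h' => noncrossingSets_mono (Finset.erase_subset _ _) subset_rfl h'⟩)
  · exact Or.inr (hlink.imp (fun h' => ⟨hv2, h'⟩) fun h' => ⟨hv1, h'⟩)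

theorem card_le (h : IsStaircase P n C R) {s : Finset (ℕ × ℕ)} (hs : s ∈ noncrossingSets P C R) :
    s.card + 1 ≤ C.card + R.card := by
  induction hk : C.card + R.card using Nat.strong_induction_on generalizing C R s with
  | _ k ih =>
  subst hk
  obtain ⟨v, hv⟩ := h.exists_isLowerCorner
  have hcC := Finset.card_erase_add_one hv.fst_mem
  have hcR := Finset.card_erase_add_one hv.snd_mem
  have hcard := Nat.sub_le_iff_le_add.1 (Finset.pred_card_le_card_erase (s := s) (a := v))
  rcases h.erase_mem_cases hv hs with ⟨-, he⟩ | ⟨hv2, hmem⟩ | ⟨hv1, hmem⟩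
  · rw [he, Finset.card_empty] at hcard
    omega
  · have := ih _ (by omega) (h.eraseRow hv2) hmem rfl
    omega
  · have := ih _ (by omega) (h.eraseCol hv1) hmem rfl
    omega

/-- The noncrossing complex of a staircase is pure. -/
theorem exists_superset_card_eq (h : IsStaircase P n C R) {s : Finset (ℕ × ℕ)}
    (hs : s ∈ noncrossingSets P C R) :
    ∃ t ∈ noncrossingSets P C R, s ⊆ t ∧ t.card + 1 = C.card + R.card := by
  induction hk : C.card + R.card using Nat.strong_induction_on generalizing C R s with
  | _ k ih =>
  subst hk
  obtain ⟨v, hv⟩ := h.exists_isLowerCorner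
  have hcC := Finset.card_erase_add_one hv.fst_mem
  have hcR := Finset.card_erase_add_one hv.snd_mem
  -- Restoring `v` to a facet of the smaller staircase makes up for the deleted row or column.
  have extend : ∀ {C' R'}, C'.card + R'.card + 1 = C.card + R.card →
      noncrossingSets P C' R' ⊆ noncrossingSets P C R →
      (∀ t ∈ noncrossingSets P C' R', v ∉ t) →
      (∃ t ∈ noncrossingSets P C' R', s.erase v ⊆ t ∧ t.card + 1 = C'.card + R'.card) →
      ∃ t ∈ noncrossingSets P C R, s ⊆ t ∧ t.card + 1 = C.card + R.card := by
    rintro C' R' hc hsub hnot ⟨t, ht, hst, htc⟩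
    refine ⟨insert v t, hv.insert_mem (hsub ht), Finset.subset_insert_iff.2 hst, ?_⟩
    rw [Finset.card_insert_of_notMem (hnot t ht)]
    omega
  rcases h.erase_mem_cases hv hs with ⟨hv0, he⟩ | ⟨hv2, hmem⟩ | ⟨hv1, hmem⟩
  · refine ⟨insert v s, hv.insert_mem hs, Finset.subset_insert v s, ?_⟩
    rw [← Finset.insert_erase (Finset.mem_insert_self v s), Finset.erase_insert_eq_erase, he,
      h.cols_eq_singleton hv hv0, h.rows_eq_singleton hv (by rw [hv0])]
    rfl
  · exact extend (by omega) (noncrossingSets_mono subset_rfl (Finset.erase_subset _ _))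
      (fun t ht hvt => (mem_noncrossingSets_eraseRow.1 ht).2 v hvt rfl)
      (ih _ (by omega) (h.eraseRow hv2) hmem rfl)
  · exact extend (by omega) (noncrossingSets_mono (Finset.erase_subset _ _) subset_rfl)
      (fun t ht hvt => (mem_noncrossingSets_eraseCol.1 ht).2 v hvt rfl)
      (ih _ (by omega) (h.eraseCol hv1) hmem rfl)

end IsStaircase

theorem Covers.mono {n : ℕ} {C R : Finset ℕ} {s t : Finset (ℕ × ℕ)} (hs : Covers n C R s)
    (hst : s ⊆ t) : Covers n C R t :=
  ⟨hst hs.1, fun y hy => (hs.2.1 y hy).imp fun _ h => ⟨hst h.1, h.2⟩,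
    fun x hx => (hs.2.2 x hx).imp fun _ h => ⟨hst h.1, h.2⟩⟩

/-! ### Facets, ridges and the boundary -/

namespace IsStaircase

variable {P : ℕ → ℕ → Prop} {n d : ℕ} {C R : Finset ℕ} {K : PreAbstractSimplicialComplex (ℕ × ℕ)}

theorem empty_mem : (∅ : Finset (ℕ × ℕ)) ∈ noncrossingSets P C R :=
  mem_noncrossingSets.2 (by simp)

/-- A face of codimension one lies in two facets if it covers, and else in one. -/
theorem card_cofacets (h : IsStaircase P n C R) (hd : d + 1 = C.card + R.card)
    {r : Finset (ℕ × ℕ)} (hr : r ∈ noncrossingSets P C R) (hrd : r.card + 1 = d)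
    [Decidable (Covers n C R r)] :
    ({t ∈ noncrossingSets P C R | r ⊆ t ∧ t.card = d}).card
      = if Covers n C R r then 2 else 1 := by
  classical
  have hsplit : {t ∈ noncrossingSets P C R | r ⊆ t}
      = insert r {t ∈ noncrossingSets P C R | r ⊆ t ∧ t.card = d} := by
    ext t
    simp only [Finset.mem_insert, Finset.mem_filter]
    constructor
    · rintro ⟨ht, hrt⟩
      by_cases htr : t = r
      · exact Or.inl htr
      · have h1 := Finset.card_lt_card (Finset.ssubset_iff_subset_ne.2 ⟨hrt, Ne.symm htr⟩)
        have h2 := h.card_le ht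
        exact Or.inr ⟨ht, hrt, by omega⟩
    · rintro (rfl | ⟨ht, hrt, -⟩)
      · exact ⟨hr, subset_rfl⟩
      · exact ⟨ht, hrt⟩
  have hnot : r ∉ ({t ∈ noncrossingSets P C R | r ⊆ t ∧ t.card = d} : Finset _) := by
    intro hmem
    have := (Finset.mem_filter.1 hmem).2.2
    omega
  -- With `N` facets through `r`, the signed count is `(-1)^(d-1) + N (-1)^d`; comparing with
  -- `(-1)^d` or 0 gives `N = 2` or `N = 1`.
  have key := h.signedCount_eq r
  rw [signedCount, hsplit, Finset.sum_insert hnot, Finset.sum_congr rfl (g := fun _ => (-1) ^ d)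
    fun t ht => by rw [(Finset.mem_filter.1 ht).2.2], Finset.sum_const, ← hd, ← hrd,
    nsmul_eq_mul] at key
  simp only [hr, true_and] at key
  rw [← hrd]
  rcases neg_one_pow_eq_or ℤ r.card with he | he <;> split_ifs at key ⊢ <;>
    simp only [pow_succ, he] at key <;> omega

theorem mem_iff_of_nonempty (hK : ∀ s, s = ∅ ∨ s ∈ K ↔ s ∈ noncrossingSets P C R)
    {s : Finset (ℕ × ℕ)} (hs : s.Nonempty) : s ∈ K ↔ s ∈ noncrossingSets P C R := by
  rw [← hK, or_iff_right hs.ne_empty]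

theorem isGreatest_card (h : IsStaircase P n C R) (hd : d + 1 = C.card + R.card)
    (hK : ∀ s, s = ∅ ∨ s ∈ K ↔ s ∈ noncrossingSets P C R) :
    IsGreatest {k | ∃ s ∈ K, s.card = k} d := by
  have hC := Finset.card_pos.2 ⟨_, h.zero_mem⟩
  have hR := Finset.card_pos.2 ⟨_, h.top_mem⟩
  constructor
  · obtain ⟨t, ht, -, htc⟩ := h.exists_superset_card_eq empty_mem
    exact ⟨t, (mem_iff_of_nonempty hK (Finset.card_pos.1 (by omega))).2 ht, by omega⟩
  · rintro _ ⟨s, hs, rfl⟩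
    have := h.card_le ((hK s).1 (Or.inr hs))
    omega

theorem dimSucc_eq (h : IsStaircase P n C R) (hd : d + 1 = C.card + R.card)
    (hK : ∀ s, s = ∅ ∨ s ∈ K ↔ s ∈ noncrossingSets P C R) : K.dimSucc = d :=
  (h.isGreatest_card hd hK).csSup_eq

theorem isFacet_iff (h : IsStaircase P n C R) (hd : d + 1 = C.card + R.card)
    (hK : ∀ s, s = ∅ ∨ s ∈ K ↔ s ∈ noncrossingSets P C R) {t : Finset (ℕ × ℕ)} :
    K.IsFacet t ↔ t ∈ noncrossingSets P C R ∧ t.card = d := by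
  have hC := Finset.card_pos.2 ⟨_, h.zero_mem⟩
  have hR := Finset.card_pos.2 ⟨_, h.top_mem⟩
  constructor
  · intro ht
    have htm := (hK t).1 (Or.inr ht.prop)
    obtain ⟨u, hu, htu, huc⟩ := h.exists_superset_card_eq htm
    have huK := (mem_iff_of_nonempty hK (Finset.card_pos.1 (by omega))).2 hu
    have := Finset.card_le_card (ht.le_of_ge huK htu)
    have := Finset.card_le_card htu
    exact ⟨htm, by omega⟩
  · rintro ⟨ht, htc⟩
    refine ⟨(mem_iff_of_nonempty hK (Finset.card_pos.1 (by omega))).2 ht, fun u hu htu => ?_⟩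
    have := h.card_le ((hK u).1 (Or.inr hu))
    exact (Finset.eq_of_subset_of_card_le htu (by omega)).ge

theorem existsUnique_isFacet_iff (h : IsStaircase P n C R) (hd : d + 1 = C.card + R.card)
    (hK : ∀ s, s = ∅ ∨ s ∈ K ↔ s ∈ noncrossingSets P C R)
    {r : Finset (ℕ × ℕ)} (hr : r ∈ noncrossingSets P C R) (hrd : r.card + 1 = d) :
    (∃! t, K.IsFacet t ∧ r ⊆ t) ↔ ¬ Covers n C R r := by
  classical
  have hcard := h.card_cofacets hd hr hrd
  have hiff : (∃! t, K.IsFacet t ∧ r ⊆ t) ↔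
      ({t ∈ noncrossingSets P C R | r ⊆ t ∧ t.card = d}).card = 1 := by
    rw [Finset.card_eq_one_iff_existsUnique]
    refine existsUnique_congr fun t => ?_
    rw [h.isFacet_iff hd hK, Finset.mem_filter]
    tauto
  rw [hiff, hcard]
  split_ifs with hc <;> simp [hc]

/-- If the root is missing, a facet containing it and `s` loses the root. If a row or column is
missed, a facet of the staircase without that line has one point fewer than a facet of the whole,
and still misses the line. -/
theorem exists_ridge_of_not_covers (h : IsStaircase P n C R) (hd : d + 1 = C.card + R.card)
    {s : Finset (ℕ × ℕ)} (hs : s ∈ noncrossingSets P C R) (hcov : ¬ Covers n C R s) :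
    ∃ r ∈ noncrossingSets P C R, s ⊆ r ∧ r.card + 1 = d ∧ ¬ Covers n C R r := by
  by_cases hroot : (0, n) ∈ s
  swap
  · obtain ⟨t, ht, hst, htc⟩ := h.exists_superset_card_eq (h.insert_root_mem hs)
    have hmem := hst (Finset.mem_insert_self _ s)
    have := Finset.card_erase_add_one hmem
    exact ⟨t.erase (0, n), noncrossingSets_of_subset ht (Finset.erase_subset _ t),
      Finset.subset_erase.2 ⟨(Finset.subset_insert _ s).trans hst, hroot⟩, by omega,
      fun hc => Finset.notMem_erase _ t hc.1⟩
  by_cases hrow : ∀ y ∈ R, ∃ p ∈ s, p.2 = y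
  swap
  · push Not at hrow
    obtain ⟨y, hy, hys⟩ := hrow
    have hyn : y ≠ n := fun e => hys _ hroot e.symm
    obtain ⟨r, hr, hsr, hrc⟩ :=
      (h.eraseRow hyn).exists_superset_card_eq (mem_noncrossingSets_eraseRow.2 ⟨hs, hys⟩)
    have := Finset.card_erase_add_one hy
    rw [mem_noncrossingSets_eraseRow] at hr
    refine ⟨r, hr.1, hsr, by omega, fun hc => ?_⟩
    obtain ⟨p, hp, hpy⟩ := hc.2.1 y hy
    exact hr.2 p hp hpy
  by_cases hcol : ∀ x ∈ C, ∃ p ∈ s, p.1 = x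
  · exact absurd ⟨hroot, hrow, hcol⟩ hcov
  push Not at hcol
  obtain ⟨x, hx, hxs⟩ := hcol
  have hx0 : x ≠ 0 := fun e => hxs _ hroot e.symm
  obtain ⟨r, hr, hsr, hrc⟩ :=
    (h.eraseCol hx0).exists_superset_card_eq (mem_noncrossingSets_eraseCol.2 ⟨hs, hxs⟩)
  have := Finset.card_erase_add_one hx
  rw [mem_noncrossingSets_eraseCol] at hr
  refine ⟨r, hr.1, hsr, by omega, fun hc => ?_⟩
  obtain ⟨p, hp, hpx⟩ := hc.2.2 x hx
  exact hr.2 p hp hpx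

/-- A noncovering face lies in a noncovering ridge, which has a unique facet. Conversely, every
ridge above a covering face covers, so it has two facets. -/
theorem isInteriorFace_iff (h : IsStaircase P n C R)
    (hK : ∀ s, s = ∅ ∨ s ∈ K ↔ s ∈ noncrossingSets P C R) {s : Finset (ℕ × ℕ)} :
    K.IsInteriorFace s ↔ s ∈ noncrossingSets P C R ∧ Covers n C R s := by
  have hC := Finset.card_pos.2 ⟨_, h.zero_mem⟩
  obtain ⟨d, hd⟩ : ∃ d, d + 1 = C.card + R.card := ⟨C.card + R.card - 1, by omega⟩
  have hdim := h.dimSucc_eq hd hK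
  constructor
  · rintro ⟨hs, hb⟩
    have hs' := (hK s).1 (Or.inr hs)
    refine ⟨hs', by_contra fun hcov => hb ?_⟩
    obtain ⟨r, hr, hsr, hrd, hrc⟩ := h.exists_ridge_of_not_covers hd hs' hcov
    exact ⟨r, hsr, by rw [hrd, hdim], (h.existsUnique_isFacet_iff hd hK hr hrd).2 hrc⟩
  · rintro ⟨hs, hcov⟩
    refine ⟨(mem_iff_of_nonempty hK ⟨_, hcov.1⟩).2 hs, ?_⟩
    rintro ⟨r, hsr, hrd, hu⟩
    obtain ⟨t, ht, hrt⟩ := hu.exists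
    rw [h.isFacet_iff hd hK] at ht
    exact (h.existsUnique_isFacet_iff hd hK (noncrossingSets_of_subset ht.1 hrt)
      (hrd.trans hdim)).1 hu (hcov.mono hsr)

end IsStaircase

/-! ### Face polynomials as sums over faces -/

namespace PreAbstractSimplicialComplex

variable {α : Type*} {K : PreAbstractSimplicialComplex α} {A : Finset (Finset α)}

theorem faceCount_eq (hK : ∀ s, s = ∅ ∨ s ∈ K ↔ s ∈ A) (i : ℕ) :
    K.faceCount i = ({s ∈ A | s.card = i}).card := by
  rw [faceCount, ← Set.ncard_coe_finset]
  congr 1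
  ext s
  simp [hK]

/-- Each summand has degree at most `K.dimSucc`, so reading off the coefficients up to that index
loses nothing. -/
theorem hTilde_eq (K : PreAbstractSimplicialComplex α) :
    K.hTilde = ∑ j ∈ Finset.range (K.dimSucc + 1),
      (K.faceCount j : ℤ[X]) * X ^ j * (1 - X) ^ (K.dimSucc - j) := by
  rw [hTilde]
  refine (as_sum_range_C_mul_X_pow' _ (Nat.lt_succ_of_le ?_)).symm
  refine natDegree_sum_le_of_forall_le _ _ fun j hj => ?_
  have hj' : j ≤ K.dimSucc := Nat.lt_succ_iff.1 (Finset.mem_range.1 hj)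
  have h1 : natDegree (1 - X : ℤ[X]) ≤ 1 := by compute_degree
  calc _ ≤ 0 + j * 1 + (K.dimSucc - j) * 1 := by
        refine natDegree_mul_le_of_le (natDegree_mul_le_of_le (natDegree_natCast _).le
          (natDegree_pow_le_of_le j natDegree_X_le)) (natDegree_pow_le_of_le _ h1)
    _ = K.dimSucc := by omega

theorem sum_faceCount (hK : ∀ s, s = ∅ ∨ s ∈ K ↔ s ∈ A) (hd : ∀ s ∈ A, s.card ≤ K.dimSucc)
    {F : Type*} [CommRing F] (g : ℕ → F) :
    ∑ j ∈ Finset.range (K.dimSucc + 1), (K.faceCount j : F) * g j = ∑ s ∈ A, g s.card := by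
  rw [← Finset.sum_fiberwise_of_maps_to (t := Finset.range (K.dimSucc + 1)) (g := Finset.card)
    fun s hs => Finset.mem_range.2 (Nat.lt_succ_of_le (hd s hs))]
  refine Finset.sum_congr rfl fun j _ => ?_
  rw [faceCount_eq hK, ← nsmul_eq_mul, ← Finset.sum_const]
  exact Finset.sum_congr rfl fun s hs => by rw [(Finset.mem_filter.1 hs).2]

theorem aeval_fTildeInt {B : Finset (Finset α)} (hB : ∀ s, K.IsInteriorFace s ↔ s ∈ B)
    (hd : ∀ s ∈ B, s.card ≤ K.dimSucc) {F : Type*} [CommRing F] (x : F) :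
    aeval x K.fTildeInt = ∑ s ∈ B, x ^ s.card := by
  rw [← Finset.sum_fiberwise_of_maps_to (t := Finset.range (K.dimSucc + 1)) (g := Finset.card)
    fun s hs => Finset.mem_range.2 (Nat.lt_succ_of_le (hd s hs)), fTildeInt, map_sum]
  refine Finset.sum_congr rfl fun j _ => ?_
  have hcount : K.interiorFaceCount j = ({s ∈ B | s.card = j}).card := by
    rw [interiorFaceCount, ← Set.ncard_coe_finset]
    congr 1
    ext s
    simp [hB]
  rw [map_mul, map_natCast, map_pow, aeval_X, hcount, ← nsmul_eq_mul, ← Finset.sum_const]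
  exact Finset.sum_congr rfl fun s hs => by rw [(Finset.mem_filter.1 hs).2]

theorem pow_mul_aeval_hTilde [DecidableEq α] (hK : ∀ s, s = ∅ ∨ s ∈ K ↔ s ∈ A)
    (hd : ∀ s ∈ A, s.card ≤ K.dimSucc) {F : Type*} [Field F] {x : F} (hx : x ≠ 0) :
    x ^ K.dimSucc * aeval ((x + 1) / x) K.hTilde =
      ∑ s ∈ A, (-1) ^ K.dimSucc * ((∑ t ∈ A with s ⊆ t, (-1 : ℤ) ^ t.card : ℤ) : F)
        * x ^ s.card := by
  have hsub : ∀ t ∈ A, ∀ s, s ⊆ t → s ∈ A := by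
    intro t ht s hst
    rw [← hK] at ht ⊢
    rcases s.eq_empty_or_nonempty with hs | hs
    · exact Or.inl hs
    · rcases ht with rfl | ht
      · exact Or.inl (Finset.subset_empty.1 hst)
      · exact Or.inr ((K.isRelLowerSet_faces ht).2 hst hs)
  calc x ^ K.dimSucc * aeval ((x + 1) / x) K.hTilde
      = ∑ j ∈ Finset.range (K.dimSucc + 1),
          (K.faceCount j : F) * ((x + 1) ^ j * (-1) ^ (K.dimSucc - j)) := by
        rw [hTilde_eq, map_sum, Finset.mul_sum]
        refine Finset.sum_congr rfl fun j hj => ?_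
        have hj' : j ≤ K.dimSucc := Nat.lt_succ_iff.1 (Finset.mem_range.1 hj)
        have h1 : 1 - (x + 1) / x = -1 / x := by field_simp; ring
        simp only [map_mul, map_natCast, map_pow, map_sub, map_one, aeval_X]
        rw [h1, div_pow, div_pow, ← Nat.add_sub_cancel' hj', pow_add, Nat.add_sub_cancel_left]
        field_simp
    _ = ∑ t ∈ A, (x + 1) ^ t.card * (-1) ^ (K.dimSucc - t.card) := sum_faceCount hK hd _
    _ = ∑ t ∈ A, ∑ s ∈ A with s ⊆ t, (-1) ^ K.dimSucc * (-1) ^ t.card * x ^ s.card := by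
        refine Finset.sum_congr rfl fun t ht => ?_
        have hpow : {s ∈ A | s ⊆ t} = t.powerset := by
          ext s
          rw [Finset.mem_filter, Finset.mem_powerset]
          exact ⟨fun h => h.2, fun h => ⟨hsub t ht s h, h⟩⟩
        -- Splitting the exponent separates the global sign from the sign that enters the Euler
        -- characteristic.
        have hsign : (-1 : F) ^ (K.dimSucc - t.card) = (-1) ^ K.dimSucc * (-1) ^ t.card := by
          conv_rhs => rw [← Nat.sub_add_cancel (hd t ht), pow_add, mul_assoc, ← mul_pow]
          simp
        rw [hpow, ← Finset.mul_sum, hsign, mul_comm, ← Finset.sum_pow_mul_eq_add_pow]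
        simp
    _ = _ := by
        simp only [Finset.sum_filter]
        rw [Finset.sum_comm]
        refine Finset.sum_congr rfl fun s _ => ?_
        rw [Int.cast_sum, Finset.mul_sum, Finset.sum_mul]
        refine Finset.sum_congr rfl fun t _ => ?_
        split_ifs <;> simp

end PreAbstractSimplicialComplex

theorem IsStaircase.pow_mul_aeval_hTilde {P : ℕ → ℕ → Prop} {n : ℕ} {C R : Finset ℕ}
    {K : PreAbstractSimplicialComplex (ℕ × ℕ)} (h : IsStaircase P n C R)
    (hK : ∀ s, s = ∅ ∨ s ∈ K ↔ s ∈ noncrossingSets P C R)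
    {F : Type*} [Field F] {x : F} (hx : x ≠ 0) :
    x ^ K.dimSucc * aeval ((x + 1) / x) K.hTilde = aeval x K.fTildeInt := by
  classical
  have hC := Finset.card_pos.2 ⟨_, h.zero_mem⟩
  obtain ⟨d, hd⟩ : ∃ d, d + 1 = C.card + R.card := ⟨C.card + R.card - 1, by omega⟩
  have hdim := h.dimSucc_eq hd hK
  have hle : ∀ s ∈ noncrossingSets P C R, s.card ≤ K.dimSucc := fun s hs => by
    have := h.card_le hs
    omega
  rw [PreAbstractSimplicialComplex.pow_mul_aeval_hTilde hK hle hx,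
    PreAbstractSimplicialComplex.aeval_fTildeInt (B := {s ∈ noncrossingSets P C R | Covers n C R s})
      (fun s => by rw [h.isInteriorFace_iff hK, Finset.mem_filter])
      (fun s hs => hle s (Finset.mem_filter.1 hs).1), Finset.sum_filter]
  refine Finset.sum_congr rfl fun s hs => ?_
  have := h.signedCount_eq s
  rw [signedCount] at this
  rw [this, hdim, ← hd]
  by_cases hcov : Covers n C R s
  · rw [if_pos ⟨hs, hcov⟩, if_pos hcov]
    push_cast
    rw [add_assoc, pow_add, ← mul_assoc, ← mul_pow]
    simp
  · rw [if_neg fun h => hcov h.2, if_neg hcov]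
    simp

/-! ### The diagram of a path as a staircase -/

namespace NEPath

/-- The point `(x, y)` lies weakly above the path `ν`, in one of its columns. -/
def WeaklyAbove (ν : NEPath) (x y : ℕ) : Prop :=
  ∃ w : NEPath, w <+: ν ∧ w.count NEStep.E = x ∧ w.count NEStep.N ≤ y

theorem exists_prefix_count_eq (w : NEPath) {x : ℕ} (hx : x ≤ w.count NEStep.E) :
    ∃ w' : NEPath, w' <+: w ∧ w'.count NEStep.E = x := by
  induction w generalizing x with
  | nil => exact ⟨[], List.prefix_rfl, by simpa using hx.antisymm' (Nat.zero_le _)⟩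
  | cons a w ih =>
    rcases Nat.eq_zero_or_pos x with rfl | hpos
    · exact ⟨[], List.nil_prefix, rfl⟩
    cases a with
    | N =>
      obtain ⟨w', hw', hc⟩ := ih (by simpa using hx)
      exact ⟨NEStep.N :: w', (List.prefix_cons_inj _).2 hw', by simpa using hc⟩
    | E =>
      rw [List.count_cons_self] at hx
      obtain ⟨w', hw', hc⟩ := ih (x := x - 1) (by omega)
      exact ⟨NEStep.E :: w', (List.prefix_cons_inj _).2 hw', by rw [List.count_cons_self]; omega⟩

theorem WeaklyAbove.mono {ν : NEPath} ⦃x x' y y' : ℕ⦄ (h : ν.WeaklyAbove x y) (hx : x' ≤ x)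
    (hy : y ≤ y') : ν.WeaklyAbove x' y' := by
  obtain ⟨w, hw, rfl, hN⟩ := h
  obtain ⟨w', hw', hE⟩ := exists_prefix_count_eq w hx
  exact ⟨w', hw'.trans hw, hE, (hw'.sublist.count_le _).trans (hN.trans hy)⟩

theorem mem_latticePoints {ν : NEPath} {p : ℕ × ℕ} :
    p ∈ ν.latticePoints ↔ p.2 ≤ ν.count NEStep.N ∧ ν.WeaklyAbove p.1 p.2 := by
  refine and_congr_right fun _ => ⟨?_, ?_⟩
  · rintro ⟨q, ⟨w, hw, rfl⟩, hq⟩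
    exact ⟨w, hw, hq⟩
  · rintro ⟨w, hw, hq⟩
    exact ⟨_, ⟨w, hw, rfl⟩, hq⟩

/-- `WeaklyAbove` has no upper bound on the height, which makes it monotone; the top of the bounding
rectangle enters only through the set of rows. -/
theorem isStaircase (ν : NEPath) : IsStaircase ν.WeaklyAbove (ν.count NEStep.N)
    (Finset.range (ν.count NEStep.E + 1)) (Finset.range (ν.count NEStep.N + 1)) where
  mono := WeaklyAbove.mono
  zero_mem := by simp
  top_mem := by simp
  le_top y hy := Nat.lt_succ_iff.1 (Finset.mem_range.1 hy)
  left y _ := ⟨[], List.nil_prefix, rfl, Nat.zero_le _⟩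
  top x hx := WeaklyAbove.mono ⟨ν, List.prefix_rfl, rfl, le_rfl⟩
    (Nat.lt_succ_iff.1 (Finset.mem_range.1 hx)) le_rfl

/-- The diagram is closed to the left and, up to the height of `q`, upwards, so a rectangle lies in
it as soon as its lower right corner does. -/
theorem incompatibleSW_iff {ν : NEPath} {p q : ℕ × ℕ} (hq : q ∈ ν.latticePoints) :
    ν.IncompatibleSW p q ↔ Crossing ν.WeaklyAbove p q := by
  refine and_congr_right fun h1 => and_congr_right fun h2 => ⟨fun h => ?_, fun h r hr => ?_⟩
  · exact (mem_latticePoints.1 (h (show (q.1, p.2) ∈ Set.Icc p q from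
      ⟨⟨h1.le, le_rfl⟩, ⟨le_rfl, h2.le⟩⟩))).2
  · exact mem_latticePoints.2 ⟨hr.2.2.trans (mem_latticePoints.1 hq).1, h.mono hr.2.1 hr.1.2⟩

theorem mem_tamariComplex_iff (ν : NEPath) (s : Finset (ℕ × ℕ)) :
    s = ∅ ∨ s ∈ ν.tamariComplex ↔ s ∈ noncrossingSets ν.WeaklyAbove
      (Finset.range (ν.count NEStep.E + 1)) (Finset.range (ν.count NEStep.N + 1)) := by
  have hmem : ∀ p : ℕ × ℕ, p ∈ ν.latticePoints ↔ p.1 ∈ Finset.range (ν.count NEStep.E + 1) ∧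
      p.2 ∈ Finset.range (ν.count NEStep.N + 1) ∧ ν.WeaklyAbove p.1 p.2 := by
    intro p
    rw [mem_latticePoints, Finset.mem_range, Finset.mem_range, Nat.lt_succ_iff, Nat.lt_succ_iff]
    refine ⟨fun ⟨h1, h2⟩ => ⟨?_, h1, h2⟩, fun h => h.2⟩
    obtain ⟨w, hw, hE, -⟩ := h2
    exact hE ▸ hw.sublist.count_le _
  rw [mem_noncrossingSets]
  simp only [← hmem]
  constructor
  · rintro (rfl | ⟨-, hs, hc⟩)
    · simp
    · exact ⟨fun p hp => hs hp, fun p hp q hq hpq =>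
        hc p hp q hq (Or.inl ((incompatibleSW_iff (hs hq)).2 hpq))⟩
  · rintro ⟨hs, hc⟩
    rcases s.eq_empty_or_nonempty with he | hne
    · exact Or.inl he
    · refine Or.inr ⟨hne, fun p hp => hs p hp, fun p hp q hq hpq => ?_⟩
      rcases hpq with hpq | hpq
      · exact hc p hp q hq ((incompatibleSW_iff (hs q hq)).1 hpq)
      · exact hc q hq p hp ((incompatibleSW_iff (hs p hp)).1 hpq)

end NEPath

theorem mainTheorem6 (ν : NEPath) {F : Type*} [Field F] (x : F) (hx : x ≠ 0) :
    x ^ ν.tamariComplex.dimSucc * aeval ((x + 1) / x) ν.tamariComplex.hTilde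
      = aeval x ν.tamariComplex.fTildeInt :=
  ν.isStaircase.pow_mul_aeval_hTilde ν.mem_tamariComplex_iff hx
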